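/- A rooted forest on $[n]=\{1,\dots,n\}$ is a forest with vertex set $[n]$ together with a choice of one root in each of its trees. A node is a record if its label is the largest on the path from it to the root of its tree. Let $R(n,k)$ be the number of rooted forests on $[n]$ with exactly $k$ records (so $R(0,0)=1$), and set $$\mathcal R(z,t)=\sum_{n,k\ge 0}R(n,k)\frac{z^n}{n!}t^k,\qquad \mathcal T(z)=\sum_{n\ge 1}n^{n-1}\frac{z^n}{n!},$$ both regarded as formal power series in $z$ with coefficients in $\mathbb R[t]$. Then $$\mathcal R(z,t)=\exp\left(\int_0^z\frac1s\,\frac{t\,\mathcal T(s)}{1-t\,\mathcal T(s)}\,ds\right).$$ Consequently $\mathcal R(0,t)=1$ and $$\frac{\partial}{\partial z}\log\mathcal R(z,t)=\frac1z\,\frac{t\,\mathcal T(z)}{1-t\,\mathcal T(z)},$$ equivalently $$z\,\partial_z\mathcal R=t\,\mathcal T\,\mathcal R+z\,\partial_z\mathcal R\cdot t\,\mathcal T .$$ Moreover, the two summands on the right count the two kinds of rooted forests with a distinguished node. Let $R'(n,k)$ (respectively $R''(n,k)$) be the number of rooted forests on $[n]$ with $k$ records in which the node with the largest label is (respectively is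 not) a root, that is, is (is not) attached to $\circ$ when an additional root $\circ$ is joined to all the roots of the forest. Then $$\sum_{n\ge1}\sum_{k\ge0}n\,R'(n,k)\frac{z^n}{n!}t^k=t\,\mathcal T(z)\,\mathcal R(z,t),\qquad \sum_{n\ge1}\sum_{k\ge0}n\,R''(n,k)\frac{z^n}{n!}t^k=z\,\partial_z\mathcal R(z,t)\cdot t\,\mathcal T(z).$$ -/

import Mathlib

namespace RecordForest

/-- A rooted forest with label set `Fin n` (the labels `1 < 2 < ⋯ < n`, shifted by one):
an acyclic graph together with a choice of exactly one root in each connected component. -/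
@[ext]
structure RootedForest (n : ℕ) where
  /-- the underlying labelled graph -/
  graph : SimpleGraph (Fin n)
  /-- the set of roots -/
  roots : Set (Fin n)
  acyclic : graph.IsAcyclic
  existsUnique_root : ∀ v, ∃! r, r ∈ roots ∧ graph.Reachable v r

namespace RootedForest

variable {n : ℕ}

/-- A node is a record if its label is the largest along the (unique) path to the root
of its tree. -/
def IsRecord (F : RootedForest n) (v : Fin n) : Prop :=
  ∃ r ∈ F.roots, ∃ p : F.graph.Walk v r, p.IsPath ∧ ∀ w ∈ p.support, w ≤ v

/-- The number of records of a rooted forest. -/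
noncomputable def numRecords (F : RootedForest n) : ℕ :=
  {v | F.IsRecord v}.ncard

/-- The node with the largest label exists and is a root. In the tree obtained by joining all
the roots to an additional root `∘`, this says that the largest node is attached to `∘`. -/
def MaxIsRoot (F : RootedForest n) : Prop :=
  ∃ r ∈ F.roots, ∀ v, v ≤ r

instance : Finite (RootedForest n) :=
  Finite.of_injective (fun F : RootedForest n => (F.graph, F.roots)) fun F G h => by
    simp only [Prod.mk.injEq] at h
    exact RootedForest.ext h.1 h.2

theorem numRecords_le (F : RootedForest n) : F.numRecords ≤ n := by
  simpa [numRecords] using Set.ncard_le_card {v | F.IsRecord v}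

end RootedForest

/-- The forest record number `R(n, k)`: the number of rooted forests with `n` nodes
and `k` records. -/
noncomputable def forestRecordNumber (n k : ℕ) : ℕ :=
  Nat.card {F : RootedForest n // F.numRecords = k}

/-- The number of rooted forests with `n` nodes and `k` records whose largest node is a root. -/
noncomputable def maxRootNumber (n k : ℕ) : ℕ :=
  Nat.card {F : RootedForest n // F.numRecords = k ∧ F.MaxIsRoot}

/-- The number of rooted forests with `n` nodes and `k` records whose largest node is
not a root. -/
noncomputable def maxNonrootNumber (n k : ℕ) : ℕ :=
  Nat.card {F : RootedForest n // F.numRecords = k ∧ ¬ F.MaxIsRoot}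

theorem forestRecordNumber_eq_zero {n k : ℕ} (h : n < k) : forestRecordNumber n k = 0 := by
  have : IsEmpty {F : RootedForest n // F.numRecords = k} :=
    ⟨fun F => by have := F.1.numRecords_le; have := F.2; omega⟩
  exact Nat.card_of_isEmpty

theorem maxRootNumber_eq_zero {n k : ℕ} (h : n < k) : maxRootNumber n k = 0 := by
  have : IsEmpty {F : RootedForest n // F.numRecords = k ∧ F.MaxIsRoot} :=
    ⟨fun F => by have := F.1.numRecords_le; have := F.2.1; omega⟩
  exact Nat.card_of_isEmpty

theorem maxNonrootNumber_eq_zero {n k : ℕ} (h : n < k) : maxNonrootNumber n k = 0 := by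
  have : IsEmpty {F : RootedForest n // F.numRecords = k ∧ ¬ F.MaxIsRoot} :=
    ⟨fun F => by have := F.1.numRecords_le; have := F.2.1; omega⟩
  exact Nat.card_of_isEmpty

/-- The generating function `∑_{n, k} a(n, k) zⁿ / n! tᵏ`, as a power series in `z` whose
coefficients are real polynomials in `t`, for an array with `a(n, k) = 0` whenever `k > n`. -/
noncomputable def egf (a : ℕ → ℕ → ℕ) : PowerSeries (Polynomial ℝ) :=
  PowerSeries.mk fun n =>
    ∑ k ∈ Finset.range (n + 1),
      Polynomial.C ((a n k : ℝ) / (n.factorial : ℝ)) * Polynomial.X ^ k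

/-- The forest record function `R(z, t) = ∑_{n, k ≥ 0} R(n, k) zⁿ / n! tᵏ`. -/
noncomputable def forestRecordFunction : PowerSeries (Polynomial ℝ) :=
  egf forestRecordNumber

/-- The Cayley tree function `T(z) = ∑_{n ≥ 1} n ^ (n - 1) zⁿ / n!`. -/
noncomputable def cayleyTreeFunction : PowerSeries (Polynomial ℝ) :=
  PowerSeries.mk fun n =>
    if n = 0 then 0 else Polynomial.C ((n : ℝ) ^ (n - 1) / (n.factorial : ℝ))

/-- The series `t T(z)`. -/
noncomputable def tT : PowerSeries (Polynomial ℝ) :=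
  PowerSeries.C Polynomial.X * cayleyTreeFunction

/-- The quotient `t T(z) / (1 - t T(z))`. -/
noncomputable def tTQuotient : PowerSeries (Polynomial ℝ) :=
  tT * PowerSeries.invOfUnit (1 - tT) 1

/-- The quotient `f(z) / z`, for a power series `f` with zero constant term. -/
noncomputable def divZ (f : PowerSeries (Polynomial ℝ)) : PowerSeries (Polynomial ℝ) :=
  PowerSeries.mk fun n => PowerSeries.coeff (n + 1) f

/-- The formal integral `∫₀ᶻ f(s) ds`: the antiderivative with zero constant term. -/
noncomputable def integral (f : PowerSeries (Polynomial ℝ)) : PowerSeries (Polynomial ℝ) :=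
  PowerSeries.mk fun n =>
    if n = 0 then 0 else Polynomial.C ((n : ℝ)⁻¹) * PowerSeries.coeff (n - 1) f

/-- The exponential `exp(f) = ∑ fⁿ / n!`, for a power series `f` with zero constant term. -/
noncomputable def expOf (f : PowerSeries (Polynomial ℝ)) : PowerSeries (Polynomial ℝ) :=
  (PowerSeries.exp (Polynomial ℝ)).subst f

theorem constantCoeff_tT : PowerSeries.constantCoeff tT = 0 := by
  simp [tT, cayleyTreeFunction, ← PowerSeries.coeff_zero_eq_constantCoeff_apply]

theorem tTQuotient_mul : tTQuotient * (1 - tT) = tT := by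
  rw [tTQuotient, mul_assoc, PowerSeries.invOfUnit_mul _ _ (by simp [constantCoeff_tT]), mul_one]

theorem constantCoeff_tTQuotient : PowerSeries.constantCoeff tTQuotient = 0 := by
  simp [tTQuotient, constantCoeff_tT]

theorem X_mul_divZ {f : PowerSeries (Polynomial ℝ)} (hf : PowerSeries.constantCoeff f = 0) :
    PowerSeries.X * divZ f = f := by
  ext1 n
  cases n with
  | zero => simp [hf]
  | succ n => simp [divZ, PowerSeries.coeff_succ_X_mul]

theorem derivative_integral (f : PowerSeries (Polynomial ℝ)) :
    PowerSeries.derivative (Polynomial ℝ) (integral f) = f := by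
  ext1 n
  have h : ((n : ℝ) + 1) ≠ 0 := by positivity
  have h2 : ((n : Polynomial ℝ) + 1) = Polynomial.C ((n : ℝ) + 1) := by simp
  rw [PowerSeries.coeff_derivative, integral, PowerSeries.coeff_mk, if_neg (Nat.succ_ne_zero n),
    h2, mul_right_comm, ← Polynomial.C_mul]
  simp [h]

theorem constantCoeff_integral (f : PowerSeries (Polynomial ℝ)) :
    PowerSeries.constantCoeff (integral f) = 0 := by
  simp [integral, ← PowerSeries.coeff_zero_eq_constantCoeff_apply]

end RecordForest

/-! Cut a forest on `n + 1` nodes at its largest node m. The pieces are the set D of strict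
descendants of m, a forest on D, a forest h on the nodes outside D and m, and the parent of m, which
is a node of h or absent. They can be chosen freely (`Cut.glue_bijective`). The node m is a record,
no node of D is one because m lies above it, and the nodes of h keep their ancestors. Hence the
forest has one record more than h, whatever happens on D (`numRecords_glue`).

With i = |D| and j = n - i there are (i+1)^(i-1) forests on D, and the parent of m can be chosen in
1 way if m is a root, in j ways if not. So R'(n+1, k+1) is the sum of binom(n,i) (i+1)^(i-1) R(j,k),
and R'' has j R(j,k) instead of R(j,k). Since (i+1)^(i-1)/i! = (i+1)^i/(i+1)! is a coefficient of T,
these sums are the products tT·R and tT·z∂R. Adding them gives a linear differential equation, whose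
only solution with constant term 1 is the exponential.

The number (i+1)^(i-1) is itself obtained from the cut, with records ignored: the resulting
recurrence is solved by Abel's identity (`sum_choose_mul_X_add_pow`). All counting is done with
parent maps, which `toRootedForest_bijective` identifies with rooted forests. -/

namespace RecordForest
open PowerSeries

/-! ### Exponential and logarithm of formal power series -/

section FormalODE

variable {A : Type*} [CommRing A] [Algebra ℚ A]

theorem derivative_exp_subst {f : A⟦X⟧} (hf : constantCoeff f = 0) :
    derivative A ((exp A).subst f) = (exp A).subst f * derivative A f := by
  rw [derivative_subst (HasSubst.of_constantCoeff_zero' hf), derivative_exp]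

theorem constantCoeff_exp_subst {f : A⟦X⟧} (hf : constantCoeff f = 0) :
    constantCoeff ((exp A).subst f) = 1 := by
  have h : (exp A) = 1 + (exp A - 1) := by ring
  have h0 : constantCoeff ((exp A - 1).subst f) = 0 :=
    constantCoeff_subst_eq_zero hf _ (by simp)
  rw [h, subst_add (HasSubst.of_constantCoeff_zero' hf), map_add, h0,
    ← coe_substAlgHom (HasSubst.of_constantCoeff_zero' hf)]
  simp

/-- The formal initial value problem `y' = y f'`, `y(0) = 1` is solved by `exp f` only. -/
theorem eq_exp_subst_of_derivative_eq [IsAddTorsionFree A] {f y : A⟦X⟧}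
    (hf : constantCoeff f = 0) (hy : constantCoeff y = 1)
    (h : derivative A y = y * derivative A f) : y = (exp A).subst f := by
  have hf' : constantCoeff (-f) = 0 := by simp [hf]
  have key : ∀ z : A⟦X⟧, constantCoeff z = 1 → derivative A z = z * derivative A f →
      -- Any solution times exp(-f) has derivative zero and constant term one. Both `y` and exp(f)
      -- are therefore inverse to exp(-f).
      z * (exp A).subst (-f) = 1 := by
    intro z hz hd
    apply derivative.ext
    · rw [Derivation.leibniz, hd, derivative_exp_subst hf', map_neg, derivative_one]
      simp only [smul_eq_mul]
      ring
    · simp [hz, constantCoeff_exp_subst hf']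
  have h1 := key y hy h
  have h2 := key _ (constantCoeff_exp_subst hf) (derivative_exp_subst hf)
  calc y = y * ((exp A).subst f * (exp A).subst (-f)) := by rw [h2, mul_one]
    _ = (exp A).subst f * (y * (exp A).subst (-f)) := by ring
    _ = _ := by rw [h1, mul_one]

theorem derivative_log_mul_one_add_X : derivative A (log A) * (1 + X) = 1 := by
  rw [deriv_log]
  ext n
  cases n with
  | zero => simp
  | succ n => simp [mul_add, coeff_succ_mul_X, pow_succ, coeff_one]

/-- `log A` is the series of log(1 + X), and substituting `f - 1` for X turns 1 + X into `f`. -/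
theorem mul_derivative_logOf {f : A⟦X⟧} (hf : constantCoeff f = 1) :
    f * derivative A (logOf f) = derivative A f := by
  have hs : HasSubst (f - 1) := HasSubst.of_constantCoeff_zero' (by simp [hf])
  have h := congrArg (subst (f - 1)) (derivative_log_mul_one_add_X (A := A))
  rw [← coe_substAlgHom hs, map_mul, map_add, map_one, substAlgHom_X hs, coe_substAlgHom hs] at h
  rw [logOf_eq, derivative_subst hs, map_sub, derivative_one, sub_zero, ← mul_assoc]
  have h' : f * subst (f - 1) (derivative A (log A)) = 1 := by
    rwa [add_sub_cancel, mul_comm] at h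
  rw [h', one_mul]

end FormalODE

/-! ### Generating functions of arrays and the functional equation -/

theorem coeff_coeff_egf {a : ℕ → ℕ → ℕ} (ha : ∀ n k, n < k → a n k = 0) (n k : ℕ) :
    (coeff n (egf a)).coeff k = (a n k : ℝ) / n.factorial := by
  simp only [egf, coeff_mk, Polynomial.finsetSum_coeff, Polynomial.coeff_C_mul_X_pow]
  rw [Finset.sum_ite_eq]
  split_ifs with h
  · rfl
  · rw [ha n k (by simpa using h)]; simp

theorem coeff_coeff_tT_mul_zero (f : PowerSeries (Polynomial ℝ)) (n : ℕ) :
    (coeff n (tT * f)).coeff 0 = 0 := by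
  rw [tT, mul_assoc, coeff_C_mul, Polynomial.mul_coeff_zero]
  simp

theorem coeff_coeff_tT_mul_succ (f : PowerSeries (Polynomial ℝ)) (n k : ℕ) :
    (coeff (n + 1) (tT * f)).coeff (k + 1) =
      ∑ p ∈ Finset.HasAntidiagonal.antidiagonal n,
        ((p.1 + 1 : ℝ) ^ (p.1 - 1) / p.1.factorial) * (coeff p.2 f).coeff k := by
  rw [tT, mul_assoc, coeff_C_mul, Polynomial.coeff_X_mul, coeff_mul,
    Finset.Nat.antidiagonal_succ, Finset.sum_cons, Finset.sum_map, Polynomial.coeff_add,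
    Polynomial.finsetSum_coeff]
  simp only [cayleyTreeFunction, coeff_mk, if_true, zero_mul, Polynomial.coeff_zero, zero_add]
  refine Finset.sum_congr rfl fun p _ => ?_
  simp only [Function.Embedding.prodMap, Function.Embedding.coeFn_mk, Prod.map,
    Nat.succ_eq_add_one, Nat.succ_ne_zero, if_false, Polynomial.coeff_C_mul,
    Function.Embedding.refl_apply]
  congr 1
  rcases p with ⟨i, j⟩
  simp only [Nat.add_sub_cancel]
  rw [Nat.factorial_succ]
  push_cast
  have : (i.factorial : ℝ) ≠ 0 := by positivity
  have : ((i : ℝ) + 1) ≠ 0 := by positivity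
  -- The exponent `i - 1` is truncated at `i = 0`, where the base is 1 and nothing is lost.
  cases i with
  | zero => simp
  | succ i => simp only [Nat.add_sub_cancel, pow_succ]; field_simp

/-- The exponential generating function of an array given by a binomial convolution with the
numbers `(i + 1) ^ (i - 1)`, once a node is distinguished. -/
theorem egf_mul_eq_tT_mul_egf {a b : ℕ → ℕ → ℕ} (ha : ∀ n k, n < k → a n k = 0)
    (hb : ∀ n k, n < k → b n k = 0) (h0 : ∀ n, a (n + 1) 0 = 0)
    (hs : ∀ n k, a (n + 1) (k + 1) =
      ∑ p ∈ Finset.HasAntidiagonal.antidiagonal n, n.choose p.1 * (p.1 + 1) ^ (p.1 - 1) * b p.2 k) :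
    egf (fun n k => n * a n k) = tT * egf b := by
  ext n k
  rw [coeff_coeff_egf (by intro n k h; simp [ha n k h])]
  cases k with
  | zero =>
    rw [coeff_coeff_tT_mul_zero]
    cases n with
    | zero => simp
    | succ n => simp [h0]
  | succ k =>
    cases n with
    | zero => simp [constantCoeff_tT]
    | succ n =>
      rw [coeff_coeff_tT_mul_succ, hs, Nat.factorial_succ]
      push_cast
      -- The factor n + 1 of the distinguished node cancels in (n+1)!; the binomial then splits n!
      -- into i! j!.
      rw [mul_div_mul_left _ _ (by positivity), Finset.sum_div]
      refine Finset.sum_congr rfl fun p hp => ?_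
      rw [coeff_coeff_egf hb]
      obtain ⟨i, j⟩ := p
      obtain rfl : i + j = n := by simpa using hp
      have hc : ((i + j).choose i * i.factorial * j.factorial : ℝ) = (i + j).factorial := by
        rw [Nat.choose_symm_add]
        exact_mod_cast Nat.add_choose_mul_factorial_mul_factorial i j
      rw [← hc]
      have : ((i + j).choose i : ℝ) ≠ 0 := by
        exact_mod_cast (Nat.choose_pos (Nat.le_add_right i j)).ne'
      field_simp

theorem X_mul_derivative_egf {a : ℕ → ℕ → ℕ} (ha : ∀ n k, n < k → a n k = 0) :
    X * derivative (Polynomial ℝ) (egf a) = egf (fun n k => n * a n k) := by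
  ext n k
  rw [coeff_coeff_egf (by intro n k h; simp [ha n k h])]
  cases n with
  | zero => simp
  | succ n =>
    rw [coeff_succ_X_mul, coeff_derivative, ← Nat.cast_succ, mul_comm, ← nsmul_eq_mul,
      Polynomial.coeff_smul, coeff_coeff_egf ha, nsmul_eq_mul]
    push_cast
    ring

theorem egf_add {a b : ℕ → ℕ → ℕ} :
    egf (fun n k => a n k + b n k) = egf a + egf b := by
  ext1 n
  simp only [egf, coeff_mk, map_add, ← Finset.sum_add_distrib]
  refine Finset.sum_congr rfl fun k _ => ?_
  push_cast
  rw [add_div, Polynomial.C_add, add_mul]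

/-- The analytic part: the functional equation determines the record function. -/
theorem forestRecordFunction_of_equation (h0 : constantCoeff forestRecordFunction = 1)
    (h : X * derivative (Polynomial ℝ) forestRecordFunction =
      tT * forestRecordFunction + X * derivative (Polynomial ℝ) forestRecordFunction * tT) :
    forestRecordFunction = expOf (integral (divZ tTQuotient)) ∧
      derivative (Polynomial ℝ) (logOf forestRecordFunction) = divZ tTQuotient := by
  have hne : (1 - tT : PowerSeries (Polynomial ℝ)) ≠ 0 := by
    intro h
    have := congrArg constantCoeff h
    simp [constantCoeff_tT] at this
  have hX := X_mul_divZ constantCoeff_tTQuotient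
  have hd : derivative (Polynomial ℝ) forestRecordFunction =
      forestRecordFunction * divZ tTQuotient := by
    have hq := tTQuotient_mul
    rw [← hX] at hq
    -- Power series over ℝ[t] form a domain, so z(1 - tT) can be cancelled.
    apply mul_left_cancel₀ (mul_ne_zero (X_ne_zero (R := Polynomial ℝ)) hne)
    linear_combination h - forestRecordFunction * hq
  refine ⟨?_, ?_⟩
  · apply eq_exp_subst_of_derivative_eq (constantCoeff_integral _) h0
    rw [derivative_integral, hd]
  · have hR : forestRecordFunction ≠ 0 := by
      intro h; rw [h] at h0; simp at h0
    apply mul_left_cancel₀ hR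
    rw [mul_derivative_logOf h0, hd]

end RecordForest

/-! ### Forests as parent maps -/

namespace RecordForest

/-- A rooted forest on `α`, encoded by the map sending a node to its parent, if there is one. -/
@[ext]
structure ParentFun (α : Type*) where
  /-- the parent of a node, or `none` at a root -/
  par : α → Option α
  wf : WellFounded fun b a => par a = some b

namespace ParentFun

variable {α β : Type*}

instance [Finite α] : Finite (ParentFun α) :=
  Finite.of_injective ParentFun.par fun _ _ h => ParentFun.ext h

/-- `f.Anc a b` says that `b` is an ancestor of `a`, or `a` itself. -/
def Anc (f : ParentFun α) : α → α → Prop :=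
  Relation.ReflTransGen fun a b => f.par a = some b

/-- A node is a record if no ancestor has a larger label. -/
def IsRecord [LE α] (f : ParentFun α) (v : α) : Prop :=
  ∀ w, f.Anc v w → w ≤ v

/-- The number of records. -/
noncomputable def numRecords [LE α] (f : ParentFun α) : ℕ :=
  {v | f.IsRecord v}.ncard

theorem Anc.refl (f : ParentFun α) (a : α) : f.Anc a a := Relation.ReflTransGen.refl

theorem Anc.head {f : ParentFun α} {a b c : α} (h : f.par a = some b) (h' : f.Anc b c) :
    f.Anc a c := Relation.ReflTransGen.head h h'

theorem anc_iff {f : ParentFun α} {a c : α} :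
    f.Anc a c ↔ a = c ∨ ∃ b, f.par a = some b ∧ f.Anc b c :=
  Relation.ReflTransGen.cases_head_iff

theorem anc_iff_of_par_eq_some {f : ParentFun α} {a b c : α} (h : f.par a = some b) :
    f.Anc a c ↔ a = c ∨ f.Anc b c := by
  rw [anc_iff]; simp [h]

theorem anc_iff_of_par_eq_none {f : ParentFun α} {a c : α} (h : f.par a = none) :
    f.Anc a c ↔ a = c := by
  rw [anc_iff]; simp [h]

/-- A cycle through `a` also passes through its parent, so it would descend forever in the
well-founded parent relation. -/
theorem not_anc_of_par_eq_some (f : ParentFun α) {a b : α} (h : f.par a = some b) :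
    ¬ f.Anc b a := by
  induction a using f.wf.induction generalizing b with
  | _ a ih =>
    intro hba
    rcases anc_iff.1 hba with rfl | ⟨c, hc, hca⟩
    · exact ih b h h (Anc.refl f b)
    · exact ih b h hc (hca.tail h)

theorem par_ne_self (f : ParentFun α) (a : α) : f.par a ≠ some a := fun h =>
  f.not_anc_of_par_eq_some h (Anc.refl f a)

/-- Relabelling the nodes. -/
def relabel (e : α ≃ β) (f : ParentFun α) : ParentFun β where
  par b := (f.par (e.symm b)).map e
  wf := by
    refine Subrelation.wf ?_ (InvImage.wf e.symm f.wf)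
    intro a b h
    obtain ⟨c, hc, rfl⟩ := Option.map_eq_some_iff.1 h
    simpa [InvImage] using hc

/-- The equivalence given by relabelling the nodes. -/
def relabelEquiv (e : α ≃ β) : ParentFun α ≃ ParentFun β where
  toFun := relabel e
  invFun := relabel e.symm
  left_inv f := by ext1; funext a; simp [relabel, Function.comp_def]
  right_inv f := by ext1; funext a; simp [relabel, Function.comp_def]

theorem anc_relabel (e : α ≃ β) {f : ParentFun α} {a b : α} (h : f.Anc a b) :
    (f.relabel e).Anc (e a) (e b) :=
  Relation.ReflTransGen.lift e (fun a b (h : f.par a = some b) => by simp [relabel, Function.onFun, h]) _ _ h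

theorem anc_relabel_iff (e : α ≃ β) {f : ParentFun α} {a b : α} :
    (f.relabel e).Anc (e a) (e b) ↔ f.Anc a b := by
  refine ⟨fun h => ?_, anc_relabel e⟩
  have := anc_relabel e.symm h
  rwa [show (f.relabel e).relabel e.symm = f from (relabelEquiv e).left_inv f,
    e.symm_apply_apply, e.symm_apply_apply] at this

theorem numRecords_relabel [LE α] [LE β] (e : α ≃o β) (f : ParentFun α) :
    (f.relabel e.toEquiv).numRecords = f.numRecords := by
  have h : {v | (f.relabel e.toEquiv).IsRecord v} = e '' {v | f.IsRecord v} := by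
    ext b
    obtain ⟨a, rfl⟩ := e.surjective b
    rw [e.injective.mem_set_image]
    simp only [Set.mem_ofPred_eq, IsRecord]
    rw [e.surjective.forall]
    refine forall_congr' fun w => ?_
    rw [e.le_iff_le]
    exact imp_congr_left (anc_relabel_iff e.toEquiv)
  rw [numRecords, h, Set.ncard_image_of_injective _ e.injective, numRecords]

theorem card_eq_of_card_eq {n : ℕ} [Finite α] (h : Nat.card α = n) :
    Nat.card (ParentFun α) = Nat.card (ParentFun (Fin n)) :=
  Nat.card_congr (relabelEquiv (Finite.equivFinOfCardEq h))

/-- Records depend on the order of the labels, so the relabelling has to be the monotone one. -/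
theorem card_numRecords_eq_of_card_eq {n : ℕ} [LinearOrder α] [Finite α] (h : Nat.card α = n)
    (k : ℕ) : Nat.card {f : ParentFun α // f.numRecords = k} =
      Nat.card {f : ParentFun (Fin n) // f.numRecords = k} := by
  have := Fintype.ofFinite α
  have e : α ≃o Fin n :=
    (Fintype.orderIsoFinOfCardEq α (by rw [← h, Nat.card_eq_fintype_card])).symm
  exact Nat.card_congr ((relabelEquiv e.toEquiv).subtypeEquiv fun f => by
    rw [← numRecords_relabel e f]; rfl)

/-! ### Cutting a forest at a node -/

section Glue

open Classical in
/-- The part of an optional node lying in `S`. -/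
noncomputable def restrictOption (S : Set α) (o : Option α) : Option S :=
  o.bind fun b => if hb : b ∈ S then some ⟨b, hb⟩ else none

@[simp]
theorem restrictOption_none (S : Set α) : restrictOption S none = none := rfl

theorem restrictOption_some_of_mem {S : Set α} {b : α} (hb : b ∈ S) :
    restrictOption S (some b) = some ⟨b, hb⟩ := by
  simp [restrictOption, hb]

theorem restrictOption_some_of_notMem {S : Set α} {b : α} (hb : b ∉ S) :
    restrictOption S (some b) = none := by
  simp [restrictOption, hb]

theorem eq_some_of_restrictOption_eq_some {S : Set α} {o : Option α} {b : S}
    (h : restrictOption S o = some b) : o = some b.1 := by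
  cases o with
  | none => simp at h
  | some a =>
    by_cases ha : a ∈ S
    · rw [restrictOption_some_of_mem ha] at h
      cases h
      rfl
    · rw [restrictOption_some_of_notMem ha] at h
      simp at h

/-- The forest induced on a set of nodes. -/
noncomputable def restrict (f : ParentFun α) (S : Set α) : ParentFun S where
  par a := restrictOption S (f.par a)
  wf := Subrelation.wf (fun h => eq_some_of_restrictOption_eq_some h)
    (InvImage.wf Subtype.val f.wf)

/-- The nodes other than `m` and outside `D`. -/
def rest (m : α) (D : Set α) : Set α := {a | a ≠ m ∧ a ∉ D}

variable {m : α} {D : Set α}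

open Classical in
/-- The parent map of `ParentFun.glue`. -/
noncomputable def gluePar (m : α) (D : Set α) (g : ParentFun D) (h : ParentFun (rest m D))
    (o : Option (rest m D)) (a : α) : Option α :=
  if hm : a = m then o.map Subtype.val
  else if ha : a ∈ D then some ((g.par ⟨a, ha⟩).elim m Subtype.val)
  else (h.par ⟨a, hm, ha⟩).map Subtype.val

section

variable (g : ParentFun D) (h : ParentFun (rest m D)) (o : Option (rest m D))

@[simp]
theorem gluePar_self : gluePar m D g h o m = o.map Subtype.val := by
  simp [gluePar]

theorem gluePar_mem (hm : m ∉ D) (a : D) :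
    gluePar m D g h o a = some ((g.par a).elim m Subtype.val) := by
  have : a.1 ≠ m := fun h => hm (h ▸ a.2)
  simp [gluePar, this]

@[simp]
theorem gluePar_rest (a : rest m D) :
    gluePar m D g h o a = (h.par a).map Subtype.val := by
  simp [gluePar, a.2.1, a.2.2]

theorem eq_or_mem_or_mem_rest (m : α) (D : Set α) (a : α) :
    a = m ∨ (∃ d : D, a = d) ∨ ∃ e : rest m D, a = e := by
  by_cases h1 : a = m
  · exact Or.inl h1
  by_cases h2 : a ∈ D
  · exact Or.inr (Or.inl ⟨⟨a, h2⟩, rfl⟩)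
  · exact Or.inr (Or.inr ⟨⟨a, h1, h2⟩, rfl⟩)

/-- The forest obtained from a forest `h` outside `D` and `m` by attaching `m` at the node `o`
(or as a new root), and then the forest `g` on `D` at `m`. -/
noncomputable def glue (hm : m ∉ D) : ParentFun α where
  par := gluePar m D g h o
  wf := by
    -- Parents never lead out of `rest m D`, the parent of `m` lies there, and a chain from `D`
    -- stays in `D` until it meets `m`. Accessibility is proved in this order.
    have hE : ∀ e : rest m D, Acc (fun b a => gluePar m D g h o a = some b) e := by
      intro e
      induction e using h.wf.induction with
      | _ e ih =>
        refine ⟨_, fun y hy => ?_⟩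
        rw [gluePar_rest, Option.map_eq_some_iff] at hy
        obtain ⟨c, hc, rfl⟩ := hy
        exact ih c hc
    have hM : Acc (fun b a => gluePar m D g h o a = some b) m := by
      refine ⟨_, fun y hy => ?_⟩
      rw [gluePar_self, Option.map_eq_some_iff] at hy
      obtain ⟨c, hc, rfl⟩ := hy
      exact hE c
    have hD : ∀ e : D, Acc (fun b a => gluePar m D g h o a = some b) e := by
      intro e
      induction e using g.wf.induction with
      | _ e ih =>
        refine ⟨_, fun y hy => ?_⟩
        rw [gluePar_mem g h o hm, Option.some_inj] at hy
        subst hy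
        cases hc : g.par e with
        | none => exact hM
        | some c => exact ih c hc
    refine ⟨fun a => ?_⟩
    obtain rfl | ⟨d, rfl⟩ | ⟨e, rfl⟩ := eq_or_mem_or_mem_rest m D a
    exacts [hM, hD d, hE e]

variable (hm : m ∉ D)

theorem anc_glue_rest {e : rest m D} {w : α} :
    (glue g h o hm).Anc e w ↔ ∃ w' : rest m D, w = w' ∧ h.Anc e w' := by
  constructor
  · intro H
    induction H with
    | refl => exact ⟨e, rfl, Anc.refl h e⟩
    | tail _ hbc ih =>
      obtain ⟨b', rfl, hb⟩ := ih
      change gluePar m D g h o b' = _ at hbc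
      rw [gluePar_rest, Option.map_eq_some_iff] at hbc
      obtain ⟨c, hc, rfl⟩ := hbc
      exact ⟨c, rfl, hb.tail hc⟩
  · rintro ⟨w', rfl, H⟩
    refine Relation.ReflTransGen.lift Subtype.val (fun a b hab => ?_) _ _ H
    change gluePar m D g h o a = _
    rw [gluePar_rest, show h.par a = some b from hab, Option.map_some]

theorem anc_glue_mem (d : D) : (glue g h o hm).Anc d m := by
  induction d using g.wf.induction with
  | _ d ih =>
    refine Anc.head (gluePar_mem g h o hm d) ?_
    cases hc : g.par d with
    | none => exact Anc.refl _ m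
    | some c => exact ih c hc

/-- This recovers `D` from the glued forest, which gives injectivity in the first component of a
cut. -/
theorem mem_iff_anc_glue {a : α} : a ∈ D ↔ a ≠ m ∧ (glue g h o hm).Anc a m := by
  constructor
  · intro ha
    exact ⟨fun h => hm (h ▸ ha), anc_glue_mem g h o hm ⟨a, ha⟩⟩
  · rintro ⟨h1, h2⟩
    by_contra h3
    obtain ⟨w, hw, -⟩ := (anc_glue_rest g h o hm (e := ⟨a, h1, h3⟩)).1 h2
    exact w.2.1 hw.symm

/-- The new record is `m`. Nodes of `D` have the larger ancestor `m`, and nodes of `rest m D` have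
the same ancestors as in `h`. -/
theorem numRecords_glue [LinearOrder α] [Finite α] (hmax : ∀ a, a ≤ m) :
    (glue g h o hm).numRecords = h.numRecords + 1 := by
  have hs : {v | (glue g h o hm).IsRecord v} =
      insert m (Subtype.val '' {v | h.IsRecord v}) := by
    ext a
    simp only [Set.mem_ofPred_eq, Set.mem_insert_iff, Set.mem_image]
    obtain rfl | ⟨d, rfl⟩ | ⟨e, rfl⟩ := eq_or_mem_or_mem_rest m D a
    · exact ⟨fun _ => Or.inl rfl, fun _ w _ => hmax w⟩
    · have hd : d.1 ≠ m := fun h => hm (h ▸ d.2)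
      constructor
      · intro H
        exact absurd (le_antisymm (hmax _) (H m (anc_glue_mem g h o hm d))) hd
      · rintro (H | ⟨x, -, hx⟩)
        · exact absurd H hd
        · exact absurd (hx ▸ d.2) x.2.2
    · constructor
      · intro H
        exact Or.inr ⟨e, fun w hw => H w ((anc_glue_rest g h o hm).2 ⟨w, rfl, hw⟩), rfl⟩
      · rintro (H | ⟨x, hx, hxe⟩)
        · exact absurd H e.2.1
        · obtain rfl := Subtype.ext hxe
          intro w hw
          obtain ⟨w', rfl, hw'⟩ := (anc_glue_rest g h o hm).1 hw
          exact hx w' hw'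
  rw [numRecords, hs, Set.ncard_insert_of_notMem _ (Set.toFinite _),
    Set.ncard_image_of_injective _ Subtype.val_injective, numRecords]
  rintro ⟨x, -, hx⟩
  exact x.2.1 hx

theorem glue_injective {g' : ParentFun D} {h' : ParentFun (rest m D)} {o' : Option (rest m D)}
    (H : glue g h o hm = glue g' h' o' hm) : g = g' ∧ h = h' ∧ o = o' := by
  have key : ∀ a, gluePar m D g h o a = gluePar m D g' h' o' a :=
    fun a => congrFun (congrArg ParentFun.par H) a
  refine ⟨?_, ?_, ?_⟩
  · ext1
    funext d
    have := key d
    rw [gluePar_mem _ _ _ hm, gluePar_mem _ _ _ hm, Option.some_inj] at this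
    -- A root of `g` gets parent `m` and any other node of `D` a parent in `D`, so the two cases
    -- cannot be confused.
    have hne : ∀ x : D, x.1 ≠ m := fun x hx => hm (hx ▸ x.2)
    cases h1 : g.par d <;> cases h2 : g'.par d <;> simp only [h1, h2, Option.elim] at this ⊢
    · exact absurd this.symm (hne _)
    · exact absurd this (hne _)
    · rw [Subtype.ext this]
  · ext1
    funext e
    have := key e
    rw [gluePar_rest, gluePar_rest] at this
    exact Option.map_injective Subtype.val_injective this
  · have := key m
    rw [gluePar_self, gluePar_self] at this
    exact Option.map_injective Subtype.val_injective this

end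

/-- Restriction only forgets edges that gluing restores: a parent of a strict descendant of `m` is
`m` or another such descendant, while a parent of `m` or of a node of `rest m D` is no descendant of
`m`. -/
theorem glue_restrict (f : ParentFun α) (hm : m ∉ D) (hD : ∀ a, a ∈ D ↔ a ≠ m ∧ f.Anc a m) :
    glue (f.restrict D) (f.restrict (rest m D)) (restrictOption (rest m D) (f.par m)) hm = f := by
  ext1
  funext a
  change gluePar m D _ _ _ a = _
  obtain rfl | ⟨d, rfl⟩ | ⟨e, rfl⟩ := eq_or_mem_or_mem_rest m D a
  · rw [gluePar_self]
    cases hb : f.par a with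
    | none => rfl
    | some b =>
      have h1 := f.not_anc_of_par_eq_some hb
      have h2 : b ∈ rest a D := ⟨fun h => h1 (h ▸ Anc.refl f b), fun h => h1 ((hD b).1 h).2⟩
      rw [restrictOption_some_of_mem h2]
      rfl
  · rw [gluePar_mem _ _ _ hm]
    obtain ⟨h1, h2⟩ := (hD d).1 d.2
    obtain h3 | ⟨b, hb, hbm⟩ := anc_iff.1 h2
    · exact absurd h3 h1
    rw [hb, Option.some_inj]
    change Option.elim (restrictOption D (f.par d)) _ _ = _
    rw [hb]
    by_cases hbD : b ∈ D
    · rw [restrictOption_some_of_mem hbD]; rfl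
    · rw [restrictOption_some_of_notMem hbD]
      by_contra hne
      exact hbD ((hD b).2 ⟨fun h => hne h.symm, hbm⟩)
  · rw [gluePar_rest]
    change Option.map _ (restrictOption (rest m D) (f.par e)) = _
    cases hb : f.par e with
    | none => rfl
    | some b =>
      have h1 : ¬ f.Anc e m := fun h => e.2.2 ((hD e).2 ⟨e.2.1, h⟩)
      rw [anc_iff_of_par_eq_some hb, not_or] at h1
      have h2 : b ∈ rest m D :=
        ⟨fun h => h1.2 (h ▸ Anc.refl f b), fun h => h1.2 ((hD b).1 h).2⟩
      rw [restrictOption_some_of_mem h2]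
      rfl

/-- The data of a forest cut at the node `m`: the set of strict descendants of `m`, the forest
on them, the forest on the remaining nodes and the parent of `m`. -/
abbrev Cut (α : Type*) (m : α) : Type _ :=
  Σ D : {D : Finset α // m ∉ D}, ParentFun (D.1 : Set α) ×
    ParentFun (rest m (D.1 : Set α)) × Option (rest m (D.1 : Set α))

/-- The forest with a given cut. -/
noncomputable def Cut.glue {m : α} (x : Cut α m) : ParentFun α :=
  ParentFun.glue x.2.1 x.2.2.1 x.2.2.2 (by simpa using x.1.2)

theorem Cut.glue_bijective [Finite α] (m : α) :
    Function.Bijective (Cut.glue : Cut α m → ParentFun α) := by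
  classical
  have := Fintype.ofFinite α
  constructor
  · rintro ⟨⟨D, hD⟩, g, h, o⟩ ⟨⟨D', hD'⟩, g', h', o'⟩ H
    obtain rfl : D = D' := by
      ext a
      have h1 := mem_iff_anc_glue g h o (by simpa using hD) (a := a)
      have h2 := mem_iff_anc_glue g' h' o' (by simpa using hD') (a := a)
      simp only [Cut.glue] at H
      rw [H, ← h2] at h1
      simpa using h1
    obtain ⟨rfl, rfl, rfl⟩ := glue_injective _ _ _ _ H
    rfl
  · intro f
    refine ⟨⟨⟨Finset.univ.filter fun a => a ≠ m ∧ f.Anc a m, by simp⟩, f.restrict _,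
      f.restrict _, restrictOption _ (f.par m)⟩, ?_⟩
    exact glue_restrict f _ (by simp)

end Glue

end ParentFun

end RecordForest

/-! ### Parent maps and rooted forests -/

namespace RecordForest

namespace ParentFun

variable {α : Type*} (f : ParentFun α)

/-- The graph joining every node to its parent. -/
def graph : SimpleGraph α where
  Adj a b := f.par a = some b ∨ f.par b = some a
  symm := ⟨fun _ _ h => h.symm⟩
  loopless := ⟨fun a h => h.elim (f.par_ne_self a) (f.par_ne_self a)⟩

theorem graph_adj {a b : α} : f.graph.Adj a b ↔ f.par a = some b ∨ f.par b = some a := Iff.rfl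

/-- Once the edge to `b` is removed, no edge leaves the set of descendants of `a`, and `b` is not in
this set. -/
theorem not_reachable_graph_deleteEdges {a b : α} (h : f.par a = some b) :
    ¬ (f.graph.deleteEdges {s(a, b)}).Reachable a b := by
  have key : ∀ x y, (f.graph.deleteEdges {s(a, b)}).Adj x y → f.Anc x a → f.Anc y a := by
    intro x y hxy hx
    rw [SimpleGraph.deleteEdges_adj, graph_adj] at hxy
    obtain ⟨hxy | hxy, hne⟩ := hxy
    · obtain rfl | h' := (anc_iff_of_par_eq_some hxy).1 hx
      · rw [h, Option.some_inj] at hxy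
        simp [hxy] at hne
      · exact h'
    · exact Anc.head hxy hx
  rintro ⟨p⟩
  have : ∀ x y, (f.graph.deleteEdges {s(a, b)}).Walk x y → f.Anc x a → f.Anc y a := by
    intro x y p
    induction p with
    | nil => exact id
    | cons hadj _ ih => exact fun hx => ih (key _ _ hadj hx)
  exact f.not_anc_of_par_eq_some h (this a b p (Anc.refl f a))

theorem isAcyclic_graph : f.graph.IsAcyclic := by
  rw [SimpleGraph.isAcyclic_iff_forall_adj_isBridge]
  intro a b hab
  rw [SimpleGraph.isBridge_iff]
  obtain h | h := hab
  · exact f.not_reachable_graph_deleteEdges h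
  · rw [Sym2.eq_swap]
    exact fun H => f.not_reachable_graph_deleteEdges h H.symm

/-- Knowing that the support is the set of ancestors makes the two notions of record agree. -/
theorem exists_path_to_root (v : α) : ∃ r, f.par r = none ∧ ∃ p : f.graph.Walk v r,
    p.IsPath ∧ ∀ w, w ∈ p.support ↔ f.Anc v w := by
  induction v using f.wf.induction with
  | _ v ih =>
    cases hv : f.par v with
    | none =>
      refine ⟨v, hv, SimpleGraph.Walk.nil, SimpleGraph.Walk.IsPath.nil, fun w => ?_⟩
      rw [anc_iff_of_par_eq_none hv]
      simp [eq_comm]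
    | some b =>
      obtain ⟨r, hr, p, hp, hs⟩ := ih b hv
      have hadj : f.graph.Adj v b := Or.inl hv
      refine ⟨r, hr, SimpleGraph.Walk.cons hadj p, ?_, fun w => ?_⟩
      · rw [SimpleGraph.Walk.cons_isPath_iff]
        exact ⟨hp, fun h => f.not_anc_of_par_eq_some hv ((hs v).1 h)⟩
      · rw [anc_iff_of_par_eq_some hv, SimpleGraph.Walk.support_cons, List.mem_cons, hs w,
          eq_comm]

theorem anc_root_iff_of_reachable {v w r : α} (hr : f.par r = none)
    (h : f.graph.Reachable v w) : f.Anc v r ↔ f.Anc w r := by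
  have key : ∀ {x y}, f.par x = some y → (f.Anc x r ↔ f.Anc y r) := by
    intro x y hxy
    rw [anc_iff_of_par_eq_some hxy, or_iff_right]
    rintro rfl
    rw [hr] at hxy
    cases hxy
  obtain ⟨p⟩ := h
  induction p with
  | nil => rfl
  | cons hadj _ ih =>
    refine Iff.trans ?_ ih
    obtain h | h := hadj
    exacts [key h, (key h).symm]

theorem root_unique {v r r' : α} (hr : f.par r = none) (hr' : f.par r' = none)
    (h : f.graph.Reachable v r) (h' : f.graph.Reachable v r') : r = r' := by
  have h1 := (f.anc_root_iff_of_reachable hr h).2 (Anc.refl f r)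
  have h2 := (f.anc_root_iff_of_reachable hr h').1 h1
  exact ((anc_iff_of_par_eq_none hr').1 h2).symm

/-- The rooted forest with a given parent map. -/
def toRootedForest {n : ℕ} (f : ParentFun (Fin n)) : RootedForest n where
  graph := f.graph
  roots := {v | f.par v = none}
  acyclic := f.isAcyclic_graph
  existsUnique_root v := by
    obtain ⟨r, hr, p, -⟩ := f.exists_path_to_root v
    exact ⟨r, ⟨hr, ⟨p⟩⟩, fun r' h' => f.root_unique h'.1 hr h'.2 ⟨p⟩⟩

theorem isRecord_toRootedForest {n : ℕ} (f : ParentFun (Fin n)) (v : Fin n) :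
    f.toRootedForest.IsRecord v ↔ f.IsRecord v := by
  obtain ⟨r, hr, p, hp, hs⟩ := f.exists_path_to_root v
  constructor
  · rintro ⟨r', hr', p', hp', hle⟩ w hw
    obtain rfl := f.root_unique hr hr' ⟨p⟩ ⟨p'⟩
    have : p = p' := congrArg Subtype.val
      ((f.isAcyclic_graph.subsingleton_path _ _).elim ⟨p, hp⟩ ⟨p', hp'⟩)
    subst this
    exact hle w ((hs w).2 hw)
  · exact fun H => ⟨r, hr, p, hp, fun w hw => H w ((hs w).1 hw)⟩

theorem numRecords_toRootedForest {n : ℕ} (f : ParentFun (Fin n)) :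
    f.toRootedForest.numRecords = f.numRecords := by
  simp only [RootedForest.numRecords, numRecords, isRecord_toRootedForest]

theorem maxIsRoot_toRootedForest {n : ℕ} (f : ParentFun (Fin (n + 1))) :
    f.toRootedForest.MaxIsRoot ↔ f.par (Fin.last n) = none := by
  constructor
  · rintro ⟨r, hr, hmax⟩
    rw [← Fin.last_le_iff.1 (hmax (Fin.last n))]
    exact hr
  · exact fun h => ⟨Fin.last n, h, Fin.le_last⟩

/-- Induction from the roots outwards: an edge from `a` to its `f`-parent `b` can only be reversed
in `g` if `a` is the `g`-parent of `b`, hence by induction its `f`-parent, which makes a cycle. -/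
theorem eq_of_graph_eq {f g : ParentFun α} (hg : f.graph = g.graph)
    (hr : ∀ a, f.par a = none ↔ g.par a = none) : f = g := by
  ext1
  funext a
  induction a using f.wf.induction with
  | _ a ih =>
    cases ha : f.par a with
    | none => exact ((hr a).1 ha).symm
    | some b =>
      have hadj : f.graph.Adj a b := Or.inl ha
      rw [hg] at hadj
      obtain h | h := hadj
      · exact h.symm
      · rw [← ih b ha] at h
        exact absurd (Anc.head h (Anc.refl f a)) (f.not_anc_of_par_eq_some ha)

end ParentFun

namespace RootedForest

variable {n : ℕ} (F : RootedForest n)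

theorem exists_path_to_root (v : Fin n) :
    ∃ r ∈ F.roots, ∃ p : F.graph.Walk v r, p.IsPath := by
  obtain ⟨r, ⟨hr, hreach⟩, -⟩ := F.existsUnique_root v
  obtain ⟨p, hp⟩ := hreach.exists_isPath
  exact ⟨r, hr, p, hp⟩

/-- The distance to the root and the next node towards the root, where there is one, can be read
off any path to a root. -/
theorem exists_length_and_snd : ∃ (len : Fin n → ℕ) (nxt : Fin n → Fin n),
    ∀ v, ∀ r ∈ F.roots, ∀ p : F.graph.Walk v r, p.IsPath → p.length = len v ∧ p.snd = nxt v := by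
  choose r hr p hp using F.exists_path_to_root
  refine ⟨fun v => (p v).length, fun v => (p v).snd, fun v r' hr' q hq => ?_⟩
  obtain rfl : r' = r v := (F.existsUnique_root v).unique ⟨hr', ⟨q⟩⟩ ⟨hr v, ⟨p v⟩⟩
  have : q = p v := congrArg Subtype.val ((F.acyclic.subsingleton_path _ _).elim ⟨q, hq⟩ ⟨p v, hp v⟩)
  subst this
  exact ⟨rfl, rfl⟩

/-- The parent of a non-root is the second node on its path to the root; the length of that path
decreases, which gives well-foundedness. -/
theorem exists_toRootedForest_eq : ∃ f : ParentFun (Fin n), f.toRootedForest = F := by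
  classical
  obtain ⟨len, nxt, H⟩ := F.exists_length_and_snd
  have hroot : ∀ v ∈ F.roots, len v = 0 := fun v hv =>
    (H v v hv SimpleGraph.Walk.nil SimpleGraph.Walk.IsPath.nil).1.symm
  have hcons : ∀ v w r, r ∈ F.roots → ∀ (h : F.graph.Adj v w) (p : F.graph.Walk w r),
      (SimpleGraph.Walk.cons h p).IsPath → v ∉ F.roots ∧ len v = len w + 1 ∧ nxt v = w := by
    intro v w r hr h p hp
    have h1 := H v r hr _ hp
    have h2 := H w r hr p hp.of_cons
    rw [SimpleGraph.Walk.length_cons, SimpleGraph.Walk.snd_cons, h2.1] at h1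
    exact ⟨fun hv => by have := hroot v hv; omega, h1.1.symm, h1.2.symm⟩
  have hnext : ∀ v, v ∉ F.roots → F.graph.Adj v (nxt v) ∧ len v = len (nxt v) + 1 := by
    intro v hv
    obtain ⟨r, hr, p, hp⟩ := F.exists_path_to_root v
    cases p with
    | nil => exact absurd hr hv
    | cons h q =>
      obtain ⟨-, h1, h2⟩ := hcons v _ r hr h q hp
      rw [h2]
      exact ⟨h, h1⟩
  refine ⟨⟨fun v => if v ∈ F.roots then none else some (nxt v), ?_⟩, ?_⟩
  · refine Subrelation.wf ?_ (measure len).wf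
    intro b a hab
    change len b < len a
    by_cases ha : a ∈ F.roots
    · simp [ha] at hab
    · rw [if_neg ha, Option.some_inj] at hab
      subst hab
      have := (hnext a ha).2
      omega
  · have hpar : ∀ v w, (if v ∈ F.roots then none else some (nxt v)) = some w ↔
        v ∉ F.roots ∧ nxt v = w := by
      intro v w
      by_cases hv : v ∈ F.roots <;> simp [hv]
    ext v w
    · change (_ = some w ∨ _ = some v) ↔ _
      rw [hpar, hpar]
      constructor
      · rintro (⟨h, rfl⟩ | ⟨h, rfl⟩)
        exacts [(hnext v h).1, (hnext w h).1.symm]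
      · intro hadj
        obtain ⟨r, hr, p, hp⟩ := F.exists_path_to_root v
        -- If the path from `v` to the root meets the neighbour `w`, acyclicity makes `w` its second
        -- node. Otherwise prepending `w` gives the path from `w`, and `v` is the parent of `w`.
        by_cases hw : w ∈ p.support
        · have h1 := F.acyclic.eq_snd_of_adj_start hp hadj hw
          cases p with
          | nil =>
            rw [SimpleGraph.Walk.support_nil, List.mem_singleton] at hw
            exact absurd hw hadj.ne'
          | cons h q =>
            rw [SimpleGraph.Walk.snd_cons] at h1
            subst h1
            obtain ⟨h2, -, h3⟩ := hcons v _ r hr h q hp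
            exact Or.inl ⟨h2, h3⟩
        · have hp' : (SimpleGraph.Walk.cons hadj.symm p).IsPath :=
            (SimpleGraph.Walk.cons_isPath_iff _ _).2 ⟨hp, hw⟩
          obtain ⟨h2, -, h3⟩ := hcons w v r hr _ p hp'
          exact Or.inr ⟨h2, h3⟩
    · change (if v ∈ F.roots then none else some (nxt v)) = none ↔ _
      by_cases hv : v ∈ F.roots <;> simp [hv]

end RootedForest

theorem ParentFun.toRootedForest_bijective (n : ℕ) :
    Function.Bijective (ParentFun.toRootedForest : ParentFun (Fin n) → RootedForest n) := by
  refine ⟨fun f g h => ?_, RootedForest.exists_toRootedForest_eq⟩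
  refine ParentFun.eq_of_graph_eq (congrArg RootedForest.graph h) fun a => ?_
  exact Set.ext_iff.1 (congrArg RootedForest.roots h) a

/-- Rooted forests are the same as parent maps. -/
noncomputable def parentFunEquiv (n : ℕ) : ParentFun (Fin n) ≃ RootedForest n :=
  Equiv.ofBijective _ (ParentFun.toRootedForest_bijective n)

theorem forestRecordNumber_eq (n k : ℕ) :
    forestRecordNumber n k = Nat.card {f : ParentFun (Fin n) // f.numRecords = k} :=
  (Nat.card_congr ((parentFunEquiv n).subtypeEquiv fun f => by
    rw [← f.numRecords_toRootedForest]; rfl)).symm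

theorem maxRootNumber_eq (n k : ℕ) : maxRootNumber (n + 1) k =
    Nat.card {f : ParentFun (Fin (n + 1)) // f.numRecords = k ∧ f.par (Fin.last n) = none} :=
  (Nat.card_congr ((parentFunEquiv (n + 1)).subtypeEquiv fun f => by
    rw [← f.numRecords_toRootedForest, ← f.maxIsRoot_toRootedForest]; rfl)).symm

theorem maxNonrootNumber_eq (n k : ℕ) : maxNonrootNumber (n + 1) k =
    Nat.card {f : ParentFun (Fin (n + 1)) // f.numRecords = k ∧ f.par (Fin.last n) ≠ none} :=
  (Nat.card_congr ((parentFunEquiv (n + 1)).subtypeEquiv fun f => by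
    rw [← f.numRecords_toRootedForest, ne_eq, ← f.maxIsRoot_toRootedForest]; rfl)).symm

end RecordForest

/-! ### Abel's identity -/

namespace RecordForest

open Finset.HasAntidiagonal

section Abel

open Polynomial

/-- An identity of Abel's. -/
theorem sum_choose_mul_X_add_pow (n : ℕ) :
    ∑ p ∈ antidiagonal n, C ((n.choose p.1 : ℚ) * (p.1 + 1) ^ (p.1 - 1)) * (X + C (p.2 : ℚ)) ^ p.2 =
      (X + C (n + 1 : ℚ)) ^ n := by
  induction n with
  | zero => simp
  | succ n ih =>
    rw [← sub_eq_zero]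
    set Q := ∑ p ∈ antidiagonal (n + 1),
      C (((n + 1).choose p.1 : ℚ) * (p.1 + 1) ^ (p.1 - 1)) * (X + C (p.2 : ℚ)) ^ p.2 with hQ
    -- Differentiating both sides gives n + 1 times the identity for n with X replaced by X + 1, so
    -- the two sides differ by a constant.
    have hderiv : derivative (Q - (X + C ((n + 1 : ℕ) + 1 : ℚ)) ^ (n + 1)) = 0 := by
      have hih := congrArg (fun q => q.comp (X + C 1)) ih
      simp only [Polynomial.sum_comp, mul_comp, pow_comp, add_comp, X_comp, C_comp, add_assoc,
        ← C_add] at hih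
      rw [derivative_sub, derivative_X_add_C_pow, hQ, derivative_sum, sub_eq_zero,
        Finset.Nat.antidiagonal_succ', Finset.sum_cons, Finset.sum_map]
      simp only [derivative_mul, derivative_C, zero_mul, zero_add, derivative_X_add_C_pow,
        derivative_one, Function.Embedding.prodMap, Function.Embedding.coeFn_mk, Prod.map,
        Function.Embedding.refl_apply, Nat.cast_zero, pow_zero, mul_zero, Nat.succ_eq_add_one,
        Nat.add_sub_cancel]
      rw [show (C ((n + 1 : ℕ) + 1 : ℚ)) = C (1 + (n + 1 : ℚ)) by push_cast; ring_nf, ← hih,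
        Finset.mul_sum]
      refine Finset.sum_congr rfl fun p hp => ?_
      obtain ⟨i, j⟩ := p
      obtain rfl : i + j = n := by simpa using hp
      have hc : ((i + j + 1).choose i : ℚ) * (j + 1) = (i + j + 1) * (i + j).choose i := by
        have := Nat.choose_mul_succ_eq (i + j) i
        rw [show i + j + 1 - i = j + 1 by omega] at this
        have h2 : (((i + j).choose i * (i + j + 1) : ℕ) : ℚ) =
          ((i + j + 1).choose i * (j + 1) : ℕ) := by exact_mod_cast this
        push_cast at h2
        linarith
      have hX : (X + C (((j + 1 : ℕ) : ℚ)) : ℚ[X]) = X + C (1 + (j : ℚ)) := by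
        push_cast; ring_nf
      simp only [hX]
      simp only [C_mul, ← mul_assoc]
      have hc' := congrArg (C : ℚ → ℚ[X]) hc
      simp only [C_mul] at hc'
      have h3 : (C ((j + 1 : ℕ) : ℚ) : ℚ[X]) = C ((j : ℚ) + 1) := by push_cast; rfl
      rw [h3]
      push_cast
      linear_combination (C ((i + 1 : ℚ) ^ (i - 1)) * (X + C (1 + (j : ℚ))) ^ j) * hc'
    obtain ⟨c, hc⟩ : ∃ c, Q - (X + C ((n + 1 : ℕ) + 1 : ℚ)) ^ (n + 1) = C c :=
      ⟨_, eq_C_of_natDegree_eq_zero (derivative_eq_zero.1 hderiv)⟩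
    have hev := congrArg (eval (-((n + 1 : ℕ) + 1 : ℚ))) hc
    rw [eval_sub, eval_C, hQ, eval_finsetSum] at hev
    -- The constant is found at X = -(n+2), where the right side vanishes. There X + j = -(i+1), and
    -- the sum becomes the (n+1)-st difference of x^n at 1, which is zero.
    have hzero : ∑ p ∈ antidiagonal (n + 1), eval (-((n + 1 : ℕ) + 1 : ℚ))
        (C (((n + 1).choose p.1 : ℚ) * (p.1 + 1) ^ (p.1 - 1)) * (X + C (p.2 : ℚ)) ^ p.2) = 0 := by
      have h := fwdDiff_iter_eq_sum_shift (1 : ℚ) (fun x : ℚ => x ^ n) (n + 1) 1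
      rw [fwdDiff_iter_pow_eq_zero_of_lt (Nat.lt_succ_self n)] at h
      rw [Finset.Nat.sum_antidiagonal_eq_sum_range_succ_mk]
      rw [Pi.zero_apply] at h
      rw [h]
      refine Finset.sum_congr rfl fun i hi => ?_
      have hi' : i ≤ n + 1 := by simpa [Nat.lt_succ_iff] using hi
      obtain ⟨j, hj⟩ := Nat.exists_eq_add_of_le hi'
      have hj' : n + 1 - i = j := by omega
      simp only [hj', eval_mul, eval_C, eval_pow, eval_add, eval_X]
      have h1 : -(((n + 1 : ℕ) : ℚ) + 1) + j = (-1) * (i + 1) := by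
        rw [hj]; push_cast; ring
      rw [h1, mul_pow]
      simp only [zsmul_eq_mul, nsmul_eq_mul, mul_one]
      push_cast
      have h2 : (i + 1 : ℚ) ^ (i - 1) * (i + 1) ^ j = (1 + i) ^ n := by
        rw [← pow_add, add_comm (1 : ℚ)]
        cases i with
        | zero => simp
        | succ i => congr 1; omega
      rw [← h2]
      ring
    rw [hzero] at hev
    rw [hc]
    rw [← hev]
    simp only [eval_pow, eval_add, eval_X, eval_C, neg_add_cancel]
    simp

theorem sum_choose_mul_add_one_pow (n : ℕ) :
    ∑ p ∈ antidiagonal n, n.choose p.1 * (p.1 + 1) ^ (p.1 - 1) * (p.2 + 1) ^ p.2 =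
      (n + 2) ^ n := by
  have h := congrArg (eval 1) (sum_choose_mul_X_add_pow n)
  simp only [eval_finsetSum, eval_mul, eval_C, eval_pow, eval_add, eval_X] at h
  have h' : ((∑ p ∈ antidiagonal n, n.choose p.1 * (p.1 + 1) ^ (p.1 - 1) * (p.2 + 1) ^ p.2 : ℕ) :
      ℚ) = ((n + 2) ^ n : ℕ) := by
    push_cast
    rw [show (n + 2 : ℚ) = 1 + (n + 1) by ring, ← h]
    exact Finset.sum_congr rfl fun p _ => by rw [add_comm (1 : ℚ)]
  exact_mod_cast h'

end Abel

/-! ### Counting forests by their cut at the largest node -/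

namespace ParentFun

/-- For fixed `D` the conditions bear on separate components, so the counts multiply. Trivial
conditions serve Cayley's formula, the others the record numbers. -/
theorem card_subtype_cut {α : Type*} [Fintype α] (m : α)
    (P : ∀ D : Finset α, ParentFun (rest m (D : Set α)) → Prop)
    (Q : ∀ D : Finset α, Option (rest m (D : Set α)) → Prop) :
    Nat.card {x : Cut α m // P x.1.1 x.2.2.1 ∧ Q x.1.1 x.2.2.2} =
      ∑ᶠ D : {D : Finset α // m ∉ D}, Nat.card (ParentFun (D.1 : Set α)) *
        (Nat.card {h // P D.1 h} * Nat.card {o // Q D.1 o}) := by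
  classical
  have e : {x : Cut α m // P x.1.1 x.2.2.1 ∧ Q x.1.1 x.2.2.2} ≃
      Σ D : {D : Finset α // m ∉ D}, ParentFun (D.1 : Set α) × {h // P D.1 h} × {o // Q D.1 o} :=
    { toFun := fun x => ⟨x.1.1, x.1.2.1, ⟨x.1.2.2.1, x.2.1⟩, ⟨x.1.2.2.2, x.2.2⟩⟩
      invFun := fun y => ⟨⟨y.1, y.2.1, y.2.2.1.1, y.2.2.2.1⟩, y.2.2.1.2, y.2.2.2.2⟩
      left_inv := fun _ => rfl
      right_inv := fun _ => rfl }
  rw [Nat.card_congr e, Nat.card_sigma, finsum_eq_sum_of_fintype]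
  simp only [Nat.card_prod]

theorem card_rest {n : ℕ} (m : Fin (n + 1)) {D : Finset (Fin (n + 1))} (hm : m ∉ D) :
    Nat.card (rest m (D : Set (Fin (n + 1)))) = n - D.card := by
  have h : rest m (D : Set (Fin (n + 1))) = ((insert m D)ᶜ : Finset (Fin (n + 1))) := by
    ext a; simp [rest, and_comm]
  rw [h, Nat.card_coe_set_eq, Set.ncard_coe_finset, Finset.card_compl,
    Finset.card_insert_of_notMem hm, Fintype.card_fin]
  omega

theorem finsum_finset_notMem {n : ℕ} (m : Fin (n + 1)) {t : Finset (Fin (n + 1)) → ℕ}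
    {G : ℕ → ℕ → ℕ} (h : ∀ D, m ∉ D → t D = G D.card (n - D.card)) :
    ∑ᶠ D : {D : Finset (Fin (n + 1)) // m ∉ D}, t D.1 =
      ∑ p ∈ antidiagonal n, n.choose p.1 * G p.1 p.2 := by
  rw [finsum_eq_sum_of_fintype, Finset.sum_congr rfl fun D _ => h D.1 D.2,
    ← Finset.sum_subtype ((Finset.univ.erase m).powerset)
      (fun D => by simp [Finset.subset_erase]) (fun D => G D.card (n - D.card)),
    Finset.sum_powerset_apply_card (fun i => G i (n - i)),
    Finset.card_erase_of_mem (Finset.mem_univ m), Finset.card_univ, Fintype.card_fin,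
    Nat.add_sub_cancel,
    Finset.Nat.sum_antidiagonal_eq_sum_range_succ (fun i j => n.choose i * G i j)]
  simp

/-- The factor `p.2 + 1` counts the parents of the last node: one of the `p.2` nodes outside its
tree of descendants, or none. -/
theorem card_succ (n : ℕ) :
    Nat.card (ParentFun (Fin (n + 1))) = ∑ p ∈ antidiagonal n, n.choose p.1 *
      (Nat.card (ParentFun (Fin p.1)) * (Nat.card (ParentFun (Fin p.2)) * (p.2 + 1))) := by
  have h := card_subtype_cut (Fin.last n) (fun _ _ => True) (fun _ _ => True)
  rw [← Nat.card_congr (Equiv.ofBijective _ (Cut.glue_bijective (Fin.last n))),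
    ← Nat.card_congr (Equiv.subtypeUnivEquiv (p := fun _ : Cut (Fin (n + 1)) (Fin.last n) =>
      True ∧ True) fun _ => ⟨trivial, trivial⟩), h]
  refine finsum_finset_notMem _ (t := fun D => Nat.card (ParentFun ((D : Finset (Fin (n + 1))) : Set (Fin (n + 1)))) *
    (Nat.card {_h : ParentFun (rest (Fin.last n) (D : Set (Fin (n + 1)))) // True} *
      Nat.card {_o : Option (rest (Fin.last n) (D : Set (Fin (n + 1)))) // True}))
    (G := fun i j => Nat.card (ParentFun (Fin i)) * (Nat.card (ParentFun (Fin j)) * (j + 1)))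
    fun D hD => ?_
  rw [Nat.card_congr (Equiv.subtypeUnivEquiv fun _ => trivial),
    Nat.card_congr (Equiv.subtypeUnivEquiv fun _ => trivial), Finite.card_option, card_rest _ hD,
    card_eq_of_card_eq (card_rest _ hD), card_eq_of_card_eq (n := D.card) (by simp)]

/-- Cayley's formula for rooted forests. -/
theorem card_fin (n : ℕ) : Nat.card (ParentFun (Fin n)) = (n + 1) ^ (n - 1) := by
  induction n using Nat.strong_induction_on with
  | _ n ih =>
    cases n with
    | zero =>
      exact Nat.card_eq_one_iff_unique.2 ⟨⟨fun f g => ParentFun.ext (funext fun a => a.elim0)⟩,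
        ⟨⟨fun a => a.elim0, ⟨fun a => a.elim0⟩⟩⟩⟩
    | succ n =>
      rw [card_succ, Nat.add_sub_cancel, ← sum_choose_mul_add_one_pow n]
      refine Finset.sum_congr rfl fun p hp => ?_
      obtain ⟨i, j⟩ := p
      obtain rfl : i + j = n := by simpa using hp
      rw [ih i (by omega), ih j (by omega), ← mul_assoc]
      cases j with
      | zero => simp
      | succ j => simp only [Nat.add_sub_cancel, pow_succ, mul_assoc]

/-- `Q'` is a condition on the parent of the largest node, `Q` the same condition read on the cut,
and `q j` the number of admissible parents when `j` nodes remain. -/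
theorem card_numRecords_glue {n : ℕ} (k : ℕ)
    (Q : ∀ D : Finset (Fin (n + 1)), Option (rest (Fin.last n) (D : Set (Fin (n + 1)))) → Prop)
    (Q' : Option (Fin (n + 1)) → Prop) (q : ℕ → ℕ)
    (hQ : ∀ D o, Q D o ↔ Q' (o.map Subtype.val))
    (hq : ∀ D, Fin.last n ∉ D → Nat.card {o // Q D o} = q (n - D.card)) :
    Nat.card {f : ParentFun (Fin (n + 1)) // f.numRecords = k + 1 ∧ Q' (f.par (Fin.last n))} =
      ∑ p ∈ antidiagonal n, n.choose p.1 *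
        ((p.1 + 1) ^ (p.1 - 1) * (forestRecordNumber p.2 k * q p.2)) := by
  have h := card_subtype_cut (Fin.last n) (fun _ h => h.numRecords = k) Q
  have e : {x : Cut (Fin (n + 1)) (Fin.last n) // x.2.2.1.numRecords = k ∧ Q x.1.1 x.2.2.2} ≃
      {f : ParentFun (Fin (n + 1)) // f.numRecords = k + 1 ∧ Q' (f.par (Fin.last n))} :=
    (Equiv.ofBijective _ (Cut.glue_bijective (Fin.last n))).subtypeEquiv fun x => by
      rw [Equiv.ofBijective_apply, Cut.glue, numRecords_glue _ _ _ _ Fin.le_last,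
        Nat.add_right_cancel_iff, hQ]
      change _ ↔ _ ∧ Q' (gluePar _ _ _ _ _ _)
      rw [gluePar_self]
  rw [← Nat.card_congr e, h]
  refine finsum_finset_notMem _ (t := fun D => Nat.card (ParentFun ((D : Finset (Fin (n + 1))) : Set (Fin (n + 1)))) *
    (Nat.card {h : ParentFun (rest (Fin.last n) (D : Set (Fin (n + 1)))) // h.numRecords = k} *
      Nat.card {o // Q D o}))
    (G := fun i j => (i + 1) ^ (i - 1) * (forestRecordNumber j k * q j)) fun D hD => ?_
  rw [hq D hD, card_numRecords_eq_of_card_eq (card_rest _ hD), ← forestRecordNumber_eq,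
    card_eq_of_card_eq (n := D.card) (by simp), card_fin]

theorem numRecords_ne_zero {n : ℕ} (f : ParentFun (Fin (n + 1))) : f.numRecords ≠ 0 := by
  obtain ⟨x, rfl⟩ := (Cut.glue_bijective (Fin.last n)).2 f
  rw [Cut.glue, numRecords_glue _ _ _ _ Fin.le_last]
  exact Nat.succ_ne_zero _

end ParentFun

/-! ### Recurrences for the record numbers and their generating functions -/

open ParentFun

theorem maxRootNumber_succ_zero (n : ℕ) : maxRootNumber (n + 1) 0 = 0 := by
  rw [maxRootNumber_eq]
  have : IsEmpty {f : ParentFun (Fin (n + 1)) // f.numRecords = 0 ∧ f.par (Fin.last n) = none} :=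
    ⟨fun f => f.1.numRecords_ne_zero f.2.1⟩
  exact Nat.card_of_isEmpty

theorem maxNonrootNumber_succ_zero (n : ℕ) : maxNonrootNumber (n + 1) 0 = 0 := by
  rw [maxNonrootNumber_eq]
  have : IsEmpty {f : ParentFun (Fin (n + 1)) // f.numRecords = 0 ∧ f.par (Fin.last n) ≠ none} :=
    ⟨fun f => f.1.numRecords_ne_zero f.2.1⟩
  exact Nat.card_of_isEmpty

theorem maxRootNumber_succ_succ (n k : ℕ) : maxRootNumber (n + 1) (k + 1) =
    ∑ p ∈ antidiagonal n,
      n.choose p.1 * (p.1 + 1) ^ (p.1 - 1) * forestRecordNumber p.2 k := by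
  rw [maxRootNumber_eq, card_numRecords_glue k (fun _ o => o = none) (fun o => o = none)
    (fun _ => 1) (by simp) (by simp)]
  simp only [mul_one, mul_assoc]

/-- The parent of the largest node is a distinguished node of the remaining forest. This is the
factor `p.2`, and the source of z∂ in the generating function. -/
theorem maxNonrootNumber_succ_succ (n k : ℕ) : maxNonrootNumber (n + 1) (k + 1) =
    ∑ p ∈ antidiagonal n,
      n.choose p.1 * (p.1 + 1) ^ (p.1 - 1) * (p.2 * forestRecordNumber p.2 k) := by
  rw [maxNonrootNumber_eq, card_numRecords_glue k (fun _ o => o ≠ none) (fun o => o ≠ none)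
    id (by simp) fun D hD => ?_]
  · refine Finset.sum_congr rfl fun p _ => ?_
    simp only [id]
    ring
  · have e : {o : Option (rest (Fin.last n) (D : Set (Fin (n + 1)))) // o ≠ none} ≃
        rest (Fin.last n) (D : Set (Fin (n + 1))) :=
      (Equiv.subtypeEquivRight fun _ => Option.isSome_iff_ne_none.symm).trans
        (Equiv.optionIsSomeEquiv _)
    rw [Nat.card_congr e, card_rest _ hD, id]

theorem forestRecordNumber_eq_add (n k : ℕ) :
    forestRecordNumber n k = maxRootNumber n k + maxNonrootNumber n k := by
  classical
  have e : {F : RootedForest n // F.numRecords = k} ≃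
      {F : RootedForest n // F.numRecords = k ∧ F.MaxIsRoot} ⊕
        {F : RootedForest n // F.numRecords = k ∧ ¬ F.MaxIsRoot} :=
    (Equiv.sumCompl fun F : {F : RootedForest n // F.numRecords = k} => F.1.MaxIsRoot).symm.trans
      (Equiv.sumCongr (Equiv.subtypeSubtypeEquivSubtypeInter _ _)
        (Equiv.subtypeSubtypeEquivSubtypeInter _ fun F : RootedForest n => ¬ F.MaxIsRoot))
  rw [forestRecordNumber, Nat.card_congr e, Nat.card_sum]
  rfl

theorem forestRecordNumber_zero_zero : forestRecordNumber 0 0 = 1 := by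
  rw [forestRecordNumber_eq, Nat.card_congr (Equiv.subtypeUnivEquiv fun f => by
    rw [← f.numRecords_toRootedForest]; exact Nat.le_zero.1 (RootedForest.numRecords_le _)),
    ParentFun.card_fin]
  rfl

theorem constantCoeff_forestRecordFunction :
    PowerSeries.constantCoeff forestRecordFunction = 1 := by
  simp [forestRecordFunction, egf, ← PowerSeries.coeff_zero_eq_constantCoeff_apply,
    forestRecordNumber_zero_zero]

theorem egf_maxRootNumber : egf (fun n k => n * maxRootNumber n k) =
    tT * forestRecordFunction :=
  egf_mul_eq_tT_mul_egf (fun _ _ => maxRootNumber_eq_zero)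
    (fun _ _ => forestRecordNumber_eq_zero) maxRootNumber_succ_zero maxRootNumber_succ_succ

theorem egf_maxNonrootNumber : egf (fun n k => n * maxNonrootNumber n k) =
    PowerSeries.X * PowerSeries.derivative (Polynomial ℝ) forestRecordFunction * tT := by
  rw [forestRecordFunction, X_mul_derivative_egf (fun _ _ => forestRecordNumber_eq_zero),
    mul_comm _ tT]
  exact egf_mul_eq_tT_mul_egf (fun _ _ => maxNonrootNumber_eq_zero)
    (fun _ _ h => by simp [forestRecordNumber_eq_zero h]) maxNonrootNumber_succ_zero
    maxNonrootNumber_succ_succ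

theorem X_mul_derivative_forestRecordFunction :
    PowerSeries.X * PowerSeries.derivative (Polynomial ℝ) forestRecordFunction =
      tT * forestRecordFunction +
        PowerSeries.X * PowerSeries.derivative (Polynomial ℝ) forestRecordFunction * tT := by
  rw [← egf_maxRootNumber, ← egf_maxNonrootNumber, ← egf_add, forestRecordFunction,
    X_mul_derivative_egf (fun _ _ => forestRecordNumber_eq_zero)]
  simp only [forestRecordNumber_eq_add, mul_add]

end RecordForest

theorem mainTheorem5 :
    -- the forest record function in terms of the Cayley tree function
    RecordForest.forestRecordFunction =
        RecordForest.expOf (RecordForest.integral (RecordForest.divZ RecordForest.tTQuotient)) ∧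
    -- the logarithmic derivative (the logarithm makes sense, the constant term being one)
    PowerSeries.constantCoeff RecordForest.forestRecordFunction = 1 ∧
    PowerSeries.derivative (Polynomial ℝ)
        (PowerSeries.logOf RecordForest.forestRecordFunction) =
      RecordForest.divZ RecordForest.tTQuotient ∧
    -- the same equation cleared of the quotients
    PowerSeries.X * PowerSeries.derivative (Polynomial ℝ) RecordForest.forestRecordFunction =
      RecordForest.tT * RecordForest.forestRecordFunction +
        PowerSeries.X *
          PowerSeries.derivative (Polynomial ℝ) RecordForest.forestRecordFunction *
            RecordForest.tT ∧
    -- forests with a distinguished node whose largest node is a root (attached to `∘`)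
    RecordForest.egf (fun n k => n * RecordForest.maxRootNumber n k) =
      RecordForest.tT * RecordForest.forestRecordFunction ∧
    -- forests with a distinguished node whose largest node is not a root
    RecordForest.egf (fun n k => n * RecordForest.maxNonrootNumber n k) =
      PowerSeries.X *
        PowerSeries.derivative (Polynomial ℝ) RecordForest.forestRecordFunction *
          RecordForest.tT := by
  exact ⟨(RecordForest.forestRecordFunction_of_equation
      RecordForest.constantCoeff_forestRecordFunction
      RecordForest.X_mul_derivative_forestRecordFunction).1,
    RecordForest.constantCoeff_forestRecordFunction,
    (RecordForest.forestRecordFunction_of_equation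
      RecordForest.constantCoeff_forestRecordFunction
      RecordForest.X_mul_derivative_forestRecordFunction).2,
    RecordForest.X_mul_derivative_forestRecordFunction,
    RecordForest.egf_maxRootNumber, RecordForest.egf_maxNonrootNumber⟩
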